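/- **Theorem (Ryll-Nardzewski).** Let $\mathcal L$ be a metric language: function symbols $f$ and relation symbols $R$ with finite arities, a modulus of uniform continuity for each symbol, a bound $D_R>0$ for each relation symbol and a bound $D>0$; $\mathcal L$ need not be countable. An $\mathcal L$-structure is a nonempty complete metric space $(M,d)$ of diameter at most $D$ together with maps $f^M:M^{n_f}\to M$ and $R^M:M^{m_R}\to[0,D_R]$ having the prescribed moduli of uniform continuity. Formulas are built from atomic formulas (relation symbols and the distance symbol applied to terms) using all continuous connectives $\mathbb R^k\to\mathbb R$, $k\ge 0$, and the quantifiers $\inf_x$, $\sup_x$; a sentence is a formula without free variables, $\mathrm{Th}(M)$ is the set of sentences whose value in $M$ is $0$, and a model of a theory $T$ is an $\mathcal L$-structure $N$ with $T\subseteq\mathrm{Th}(N)$. Let $M$ be a separable $\mathcal L$-structure, $T=\mathrm{Th}(M)$, and $G=\mathrm{Aut}(M)$ the group of surjective isometries of $M$ commuting with the interpretations of all symbols. Suppose that the action of $G$ on $M$ is approximately oligomorphic: for every $n\in\mathbb N$ the pseudo-distance $\inf_{g\in G}\sum_{i=1}^n d(g\cdot a_i,b_i)$ on $M^n$ is totally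 bounded. For $n\le\omega$ (where $M^\omega=M^{\mathbb N}$ has the product topology), let $G\backslash\!\backslash M^n$ be the set of closures of orbits of the diagonal action of $G$ on $M^n$. Let $\mathfrak P_n$ be the Banach algebra of definable predicates in the first $n$ variables: the separation and completion of the algebra of formulas in these variables for the norm $\|\varphi\|_T=\sup_{a\in M^n}|\varphi^M(a)|$, equivalently the closure in the bounded continuous functions on $M^n$ of the interpretations of these formulas. Let $S_n(T)$ be the set of nonzero multiplicative linear functionals $\mathfrak P_n\to\mathbb R$ of norm at most $1$, and for $a\in M^n$ let $\mathrm{tp}(a)\in S_n(T)$ be the evaluation $\varphi\mapsto\varphi^M(a)$. Then: 1. for every $n\le\omega$, the map $G\backslash\!\backslash M^n\to S_n(T)$, $\overline{G\cdot a}\mapsto\mathrm{tp}(a)$, is well defined and bijective; 2. $T$ is $\aleph_0$-categorical: any two separable models of $T$ are isomorphic. -/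

import Mathlib

open scoped BoundedContinuousFunction

universe u v w w₁ w₂

/-! ### Metric languages and structures -/

/-- A metric language: function and relation symbols with their arities, a modulus of uniform
continuity for each symbol, a bound for each relation symbol and a bound for the diameter. -/
structure MetricLanguage : Type (max (u + 1) (v + 1)) where
  Func : Type u
  funArity : Func → ℕ
  funModulus : Func → ℝ → ℝ
  funModulus_pos : ∀ f ε, 0 < ε → 0 < funModulus f ε
  Rel : Type v
  relArity : Rel → ℕ
  relModulus : Rel → ℝ → ℝ
  relModulus_pos : ∀ R ε, 0 < ε → 0 < relModulus R ε
  relBound : Rel → ℝ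
  relBound_pos : ∀ R, 0 < relBound R
  diamBound : ℝ
  diamBound_pos : 0 < diamBound

/-- The distance `d^n` on `X^n`: the sum of the distances of the coordinates. -/
noncomputable def tupleDist {X : Type*} [MetricSpace X] {n : ℕ} (x y : Fin n → X) : ℝ :=
  ∑ i, dist (x i) (y i)

namespace MetricLanguage

/-- An `L`-structure on the metric space `M`: `M` is complete, nonempty, of diameter at most the
bound of `L`, and the symbols are interpreted by maps with the prescribed moduli of uniform
continuity (with respect to `d^n`) and bounds. -/
class Structure (L : MetricLanguage.{u, v}) (M : Type w) [MetricSpace M] where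
  nonempty : Nonempty M
  complete : CompleteSpace M
  dist_le : ∀ x y : M, dist x y ≤ L.diamBound
  funMap : ∀ f : L.Func, (Fin (L.funArity f) → M) → M
  funMap_modulus : ∀ (f : L.Func) (ε : ℝ), 0 < ε → ∀ x y : Fin (L.funArity f) → M,
    tupleDist x y < L.funModulus f ε → dist (funMap f x) (funMap f y) < ε
  relMap : ∀ R : L.Rel, (Fin (L.relArity R) → M) → ℝ
  relMap_mem : ∀ (R : L.Rel) (x : Fin (L.relArity R) → M), relMap R x ∈ Set.Icc 0 (L.relBound R)
  relMap_modulus : ∀ (R : L.Rel) (ε : ℝ), 0 < ε → ∀ x y : Fin (L.relArity R) → M,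
    tupleDist x y < L.relModulus R ε → dist (relMap R x) (relMap R y) < ε

/-- The map `g` commutes with the interpretations of all symbols of `L`. -/
def Preserves (L : MetricLanguage.{u, v}) {M : Type w₁} {N : Type w₂} [MetricSpace M]
    [MetricSpace N] [L.Structure M] [L.Structure N] (g : M → N) : Prop :=
  (∀ (f : L.Func) (x : Fin (L.funArity f) → M),
    g (Structure.funMap f x) = Structure.funMap f (fun i => g (x i))) ∧
  (∀ (R : L.Rel) (x : Fin (L.relArity R) → M),
    Structure.relMap R (fun i => g (x i)) = Structure.relMap R x)

/-- Two `L`-structures are isomorphic: there is a surjective isometry commuting with the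
interpretations of all symbols. -/
def Isomorphic (L : MetricLanguage.{u, v}) (M : Type w₁) (N : Type w₂) [MetricSpace M]
    [MetricSpace N] [L.Structure M] [L.Structure N] : Prop :=
  ∃ e : M ≃ᵢ N, L.Preserves e

/-- The automorphism group of an `L`-structure. -/
def Aut (L : MetricLanguage.{u, v}) (M : Type w) [MetricSpace M] [L.Structure M] :
    Subgroup (M ≃ᵢ M) where
  carrier := {g | L.Preserves g}
  one_mem' := ⟨fun _ _ => rfl, fun _ _ => rfl⟩
  mul_mem' := by
    intro a b ha hb
    refine ⟨fun f x => ?_, fun R x => ?_⟩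
    · simp only [IsometryEquiv.mul_apply, hb.1, ha.1]
    · simp only [IsometryEquiv.mul_apply]
      rw [ha.2 R (fun i => b (x i)), hb.2]
  inv_mem' := by
    intro a ha
    refine ⟨fun f x => ?_, fun R x => ?_⟩
    · apply a.injective
      rw [ha.1]
      simp only [IsometryEquiv.apply_inv_self]
    · rw [← ha.2 R]
      simp only [IsometryEquiv.apply_inv_self]

instance Aut.instMulAction (L : MetricLanguage.{u, v}) (M : Type w) [MetricSpace M]
    [L.Structure M] : MulAction (L.Aut M) M where
  smul g x := g.1 x
  one_smul _ := rfl
  mul_smul _ _ _ := rfl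

theorem Aut.smul_def (L : MetricLanguage.{u, v}) {M : Type w} [MetricSpace M] [L.Structure M]
    (g : L.Aut M) (x : M) : g • x = g.1 x := rfl

/-! ### Terms and formulas -/

/-- Terms in the variables `x₀, x₁, …`. -/
inductive Term (L : MetricLanguage.{u, v}) : Type u
  | var (k : ℕ) : Term L
  | app (f : L.Func) (ts : Fin (L.funArity f) → Term L) : Term L

/-- Formulas. The distance symbol is a binary relation symbol; the connectives are all the
continuous functions `ℝⁿ → ℝ`, with `n = 0` allowed; the quantifiers are `inf` and `sup`. -/
inductive Formula (L : MetricLanguage.{u, v}) : Type (max u v)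
  | rel (R : L.Rel) (ts : Fin (L.relArity R) → Term L) : Formula L
  | dist (s t : Term L) : Formula L
  | conn {n : ℕ} (c : C(Fin n → ℝ, ℝ)) (φ : Fin n → Formula L) : Formula L
  | inf (k : ℕ) (φ : Formula L) : Formula L
  | sup (k : ℕ) (φ : Formula L) : Formula L

/-- The set of (indices of) variables of a term. -/
def Term.freeVars {L : MetricLanguage.{u, v}} : Term L → Set ℕ
  | .var k => {k}
  | .app _ ts => ⋃ i, (ts i).freeVars

/-- The set of (indices of) free variables of a formula. -/
def Formula.freeVars {L : MetricLanguage.{u, v}} : Formula L → Set ℕ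
  | .rel _ ts => ⋃ i, (ts i).freeVars
  | .dist s t => s.freeVars ∪ t.freeVars
  | .conn _ φ => ⋃ i, (φ i).freeVars
  | .inf k φ => φ.freeVars \ {k}
  | .sup k φ => φ.freeVars \ {k}

section Interpretation

variable {L : MetricLanguage.{u, v}} {M : Type w} [MetricSpace M] [L.Structure M]

/-- The interpretation of a term at an assignment `a` of the variables. -/
def Term.eval (a : ℕ → M) : Term L → M
  | .var k => a k
  | .app f ts => Structure.funMap f (fun i => (ts i).eval a)

/-- The interpretation of a formula at an assignment of the variables. -/
noncomputable def Formula.eval : Formula L → (ℕ → M) → ℝ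
  | .rel R ts, a => Structure.relMap R (fun i => (ts i).eval a)
  | .dist s t, a => Dist.dist (s.eval a) (t.eval a)
  | .conn c φ, a => c (fun i => (φ i).eval a)
  | .inf k φ, a => ⨅ b : M, φ.eval (Function.update a k b)
  | .sup k φ, a => ⨆ b : M, φ.eval (Function.update a k b)

end Interpretation

/-! ### Theories -/

/-- A sentence is a formula without free variables. -/
def Sentence (L : MetricLanguage.{u, v}) : Type (max u v) :=
  {φ : Formula L // φ.freeVars = ∅}

/-- The theory of `M`: the set of the sentences whose interpretation in `M` is `0`. -/
def Th (L : MetricLanguage.{u, v}) (M : Type w) [MetricSpace M] [L.Structure M] :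
    Set (Sentence L) :=
  {φ | ∀ a : ℕ → M, φ.1.eval a = 0}

/-- `M` is a model of the theory `T`. -/
def IsModel {L : MetricLanguage.{u, v}} (T : Set (Sentence L)) (M : Type w) [MetricSpace M]
    [L.Structure M] : Prop :=
  T ⊆ L.Th M

/-- `T` is `ℵ₀`-categorical: all its separable models are isomorphic. -/
def IsAleph0Categorical {L : MetricLanguage.{u, v}} (T : Set (Sentence L)) : Prop :=
  ∀ (N : Type w₁) (N' : Type w₂) [MetricSpace N] [MetricSpace N'] [L.Structure N]
    [L.Structure N'] [TopologicalSpace.SeparableSpace N] [TopologicalSpace.SeparableSpace N'],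
    IsModel T N → IsModel T N' → L.Isomorphic N N'

end MetricLanguage

/-! ### Isometric actions -/

/-- The pseudo-distance `inf_{g ∈ G} d(g • x, y)` attached to a distance function `d`. -/
noncomputable def orbitDist (G : Type*) [Group G] {X : Type*} [MulAction G X] (d : X → X → ℝ)
    (x y : X) : ℝ :=
  ⨅ g : G, d (g • x) y

/-- The action of `G` on `(X, d)` is approximately cocompact: for the distance induced by
`orbitDist`, the space of orbit closures is precompact (totally bounded). -/
def IsApproxCocompact (G : Type*) [Group G] {X : Type*} [MulAction G X] (d : X → X → ℝ) : Prop :=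
  ∀ ε : ℝ, 0 < ε → ∃ F : Set X, F.Finite ∧ ∀ x, ∃ y ∈ F, orbitDist G d x y < ε

/-- The action of `G` on the metric space `X` is approximately oligomorphic: for all `n`, the
diagonal action on `(X^n, d^n)` is approximately cocompact. -/
def IsApproxOligomorphic (G : Type*) [Group G] (X : Type*) [MetricSpace X] [MulAction G X] :
    Prop :=
  ∀ n : ℕ, IsApproxCocompact G (tupleDist : (Fin n → X) → (Fin n → X) → ℝ)

/-- Two points are equivalent if their orbits have the same closure. -/
def orbitClosureSetoid (G : Type*) [Group G] (X : Type*) [TopologicalSpace X] [MulAction G X] :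
    Setoid X :=
  Setoid.ker fun x => closure (MulAction.orbit G x)

/-- The space of orbit closures. -/
def OrbitClosures (G : Type*) [Group G] (X : Type*) [TopologicalSpace X] [MulAction G X] :
    Type _ :=
  Quotient (orbitClosureSetoid G X)

/-- The space `X^n` of `n`-tuples for `n ≤ ω`, where `n = ⊤` stands for `ω`. As a product it
carries the product topology and the diagonal actions. -/
abbrev Tuple (X : Type*) (n : ℕ∞) : Type _ :=
  {i : ℕ // (i : ℕ∞) < n} → X

namespace MetricLanguage

/-! ### Interpretations of formulas are bounded and uniformly continuous -/

section Regularity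

variable {L : MetricLanguage.{u, v}} {M : Type w} [MetricSpace M] [L.Structure M]

theorem uniformContinuous_of_modulus {Y : Type*} [MetricSpace Y] {n : ℕ} (F : (Fin n → M) → Y)
    (δ : ℝ → ℝ) (hδ : ∀ ε, 0 < ε → 0 < δ ε)
    (hF : ∀ ε : ℝ, 0 < ε → ∀ x y, tupleDist x y < δ ε → dist (F x) (F y) < ε) :
    UniformContinuous F := by
  rw [Metric.uniformContinuous_iff]
  intro ε hε
  have hn : (0 : ℝ) < n + 1 := by positivity
  refine ⟨δ ε / (n + 1), div_pos (hδ ε hε) hn, fun {x y} hxy => hF ε hε x y ?_⟩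
  have h1 : tupleDist x y ≤ n * dist x y := by
    have := Finset.sum_le_card_nsmul (Finset.univ : Finset (Fin n))
      (fun i => dist (x i) (y i)) (dist x y) (fun i _ => dist_le_pi_dist x y i)
    simpa [tupleDist] using this
  have h2 : dist x y * (n + 1) < δ ε := (lt_div_iff₀ hn).1 hxy
  nlinarith [dist_nonneg (x := x) (y := y)]

theorem Term.uniformContinuous_eval (t : Term L) :
    UniformContinuous fun a : ℕ → M => t.eval a := by
  induction t with
  | var k => exact Pi.uniformContinuous_proj _ k
  | app f ts ih =>
    exact (uniformContinuous_of_modulus _ _ (L.funModulus_pos f)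
      (Structure.funMap_modulus f)).comp (uniformContinuous_pi.2 ih)

theorem Term.eval_congr (t : Term L) {a b : ℕ → M} (h : ∀ k ∈ t.freeVars, a k = b k) :
    t.eval a = t.eval b := by
  induction t with
  | var k => exact h k rfl
  | app f ts ih =>
    simp only [Term.eval]
    congr 1
    funext i
    exact ih i fun k hk => h k (Set.mem_iUnion.2 ⟨i, hk⟩)

theorem Formula.eval_congr (φ : Formula L) : ∀ {a b : ℕ → M},
    (∀ k ∈ φ.freeVars, a k = b k) → φ.eval a = φ.eval b := by
  induction φ with
  | rel R ts =>
    intro a b h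
    simp only [Formula.eval]
    congr 1
    funext i
    exact (ts i).eval_congr fun k hk => h k (Set.mem_iUnion.2 ⟨i, hk⟩)
  | dist s t =>
    intro a b h
    simp only [Formula.eval]
    rw [s.eval_congr fun k hk => h k (Or.inl hk), t.eval_congr fun k hk => h k (Or.inr hk)]
  | conn c φ ih =>
    intro a b h
    simp only [Formula.eval]
    congr 1
    funext i
    exact ih i fun k hk => h k (Set.mem_iUnion.2 ⟨i, hk⟩)
  | inf k φ ih =>
    intro a b h
    simp only [Formula.eval]
    refine iInf_congr fun c => ih fun j hj => ?_
    by_cases hjk : j = k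
    · subst hjk; simp
    · simpa [hjk] using h j ⟨hj, hjk⟩
  | sup k φ ih =>
    intro a b h
    simp only [Formula.eval]
    refine iSup_congr fun c => ih fun j hj => ?_
    by_cases hjk : j = k
    · subst hjk; simp
    · simpa [hjk] using h j ⟨hj, hjk⟩

theorem exists_update_entourage {F : (ℕ → M) → ℝ} (hF : UniformContinuous F) (k : ℕ) {ε : ℝ}
    (hε : 0 < ε) : ∀ᶠ p : (ℕ → M) × (ℕ → M) in uniformity (ℕ → M), ∀ c : M,
      dist (F (Function.update p.1 k c)) (F (Function.update p.2 k c)) < ε := by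
  have key : UniformContinuous fun a : ℕ → M =>
      UniformFun.ofFun (fun c : M => Function.update a k c) := by
    refine (UniformFun.uniformEquivPiComm M
      (fun _ : ℕ => M)).isUniformInducing.uniformContinuous_iff.2 (uniformContinuous_pi.2 ?_)
    intro i
    by_cases hik : i = k
    · subst hik
      have : (fun a : ℕ → M => (UniformFun.uniformEquivPiComm M (fun _ : ℕ => M)
          (UniformFun.ofFun fun c : M => Function.update a i c)) i) =
          fun _ => UniformFun.ofFun id := by
        funext a
        apply UniformFun.toFun.injective
        funext c
        change Function.update a i c i = c
        simp
      exact this ▸ uniformContinuous_const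
    · have h2 : UniformContinuous fun x : M => UniformFun.ofFun (fun _ : M => x) := by
        rw [UniformContinuous, (UniformFun.hasBasis_uniformity M M).tendsto_right_iff]
        intro V hV
        filter_upwards [hV] with p hp c using hp
      have : (fun a : ℕ → M => (UniformFun.uniformEquivPiComm M (fun _ : ℕ => M)
          (UniformFun.ofFun fun c : M => Function.update a k c)) i) =
          fun a => UniformFun.ofFun (fun _ : M => a i) := by
        funext a
        apply UniformFun.toFun.injective
        funext c
        change Function.update a k c i = a i
        simp [hik]
      exact this ▸ h2.comp (Pi.uniformContinuous_proj _ i)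
  have h := (UniformFun.hasBasis_uniformity M (ℕ → M)).tendsto_right_iff.1 key
    {q | dist (F q.1) (F q.2) < ε} (hF (Metric.dist_mem_uniformity hε))
  filter_upwards [h] with p hp c using hp c

theorem abs_iInf_sub_iInf_le {ι : Type*} [Nonempty ι] {f g : ι → ℝ} {C ε : ℝ}
    (hf : ∀ i, |f i| ≤ C) (hg : ∀ i, |g i| ≤ C) (h : ∀ i, |f i - g i| ≤ ε) :
    |(⨅ i, f i) - ⨅ i, g i| ≤ ε := by
  have bf : BddBelow (Set.range f) := ⟨-C, by rintro _ ⟨i, rfl⟩; exact (abs_le.1 (hf i)).1⟩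
  have bg : BddBelow (Set.range g) := ⟨-C, by rintro _ ⟨i, rfl⟩; exact (abs_le.1 (hg i)).1⟩
  rw [abs_le]
  constructor
  · have : (⨅ i, g i) - ε ≤ ⨅ i, f i := le_ciInf fun i => by
      have h1 := ciInf_le bg i
      have h2 := (abs_le.1 (h i)).1
      linarith
    linarith
  · have : (⨅ i, f i) - ε ≤ ⨅ i, g i := le_ciInf fun i => by
      have h1 := ciInf_le bf i
      have h2 := (abs_le.1 (h i)).2
      linarith
    linarith

theorem abs_iInf_le' {ι : Type*} [Nonempty ι] {f : ι → ℝ} {C : ℝ}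
    (hf : ∀ i, |f i| ≤ C) : |⨅ i, f i| ≤ C := by
  have hC : 0 ≤ C := (abs_nonneg _).trans (hf (Classical.arbitrary ι))
  simpa using abs_iInf_sub_iInf_le (g := fun _ : ι => (0 : ℝ)) hf (fun _ => by simpa using hC)
    (by simpa using hf)

theorem uniformContinuous_iInf [Nonempty M] {F : (ℕ → M) → ℝ} (hF : UniformContinuous F) {C : ℝ}
    (hC : ∀ a, |F a| ≤ C) (k : ℕ) :
    UniformContinuous fun a : ℕ → M => ⨅ c : M, F (Function.update a k c) := by
  rw [UniformContinuous, Metric.uniformity_basis_dist_le.tendsto_right_iff]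
  intro ε hε
  filter_upwards [exists_update_entourage hF k hε] with p hp
  exact abs_iInf_sub_iInf_le (fun c => hC _) (fun c => hC _) fun c => (hp c).le

theorem Formula.bounded_and_uniformContinuous_eval (φ : Formula L) :
    (∃ C : ℝ, ∀ a : ℕ → M, |φ.eval a| ≤ C) ∧ UniformContinuous fun a : ℕ → M => φ.eval a := by
  have : Nonempty M := Structure.nonempty L
  induction φ with
  | rel R ts =>
    refine ⟨⟨L.relBound R, fun a => ?_⟩, ?_⟩
    · have := Structure.relMap_mem R (fun i => (ts i).eval a)
      simp only [Formula.eval]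
      rw [abs_of_nonneg this.1]
      exact this.2
    · exact (uniformContinuous_of_modulus _ _ (L.relModulus_pos R)
        (Structure.relMap_modulus R)).comp
          (uniformContinuous_pi.2 fun i => (ts i).uniformContinuous_eval)
  | dist s t =>
    refine ⟨⟨L.diamBound, fun a => ?_⟩, ?_⟩
    · simp only [Formula.eval]
      rw [abs_of_nonneg dist_nonneg]
      exact Structure.dist_le _ _
    · exact s.uniformContinuous_eval.dist t.uniformContinuous_eval
  | @conn n c φ ih =>
    choose C hC using fun i => (ih i).1
    have hK : IsCompact (Set.pi Set.univ fun i : Fin n => Set.Icc (-C i) (C i)) :=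
      isCompact_univ_pi fun i => isCompact_Icc
    have hmem : ∀ a : ℕ → M, (fun i => (φ i).eval a) ∈
        Set.pi Set.univ fun i : Fin n => Set.Icc (-C i) (C i) :=
      fun a i _ => abs_le.1 (hC i a)
    refine ⟨?_, ?_⟩
    · obtain ⟨B, hB⟩ := hK.exists_bound_of_continuousOn c.continuous.continuousOn
      exact ⟨B, fun a => hB _ (hmem a)⟩
    · have h1 := hK.uniformContinuousOn_of_continuous c.continuous.continuousOn
      have h2 : UniformContinuous fun a : ℕ → M => fun i => (φ i).eval a :=
        uniformContinuous_pi.2 fun i => (ih i).2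
      exact uniformContinuousOn_univ.1
        (h1.comp (uniformContinuousOn_univ.2 h2) fun a _ => hmem a)
  | inf k φ ih =>
    obtain ⟨⟨C, hC⟩, hu⟩ := ih
    exact ⟨⟨C, fun a => abs_iInf_le' fun c => hC _⟩, uniformContinuous_iInf hu hC k⟩
  | sup k φ ih =>
    obtain ⟨⟨C, hC⟩, hu⟩ := ih
    have e : ∀ a : ℕ → M, (Formula.sup k φ).eval a =
        -⨅ c : M, -φ.eval (Function.update a k c) := by
      intro a
      simp only [Formula.eval]
      rw [iSup, iInf, Real.sInf_def, neg_neg]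
      congr 1
      ext x
      simp [neg_eq_iff_eq_neg]
    refine ⟨⟨C, fun a => ?_⟩, ?_⟩
    · rw [e, abs_neg]
      exact abs_iInf_le' fun c => by rw [abs_neg]; exact hC _
    · have := uniformContinuous_iInf (F := fun a => -φ.eval a) hu.neg (C := C)
        (fun a => by rw [abs_neg]; exact hC a) k
      simp only [e]
      exact this.neg

end Regularity

/-! ### Definable predicates and types -/

section Types

variable (L : MetricLanguage.{u, v}) (M : Type w) [MetricSpace M] [L.Structure M] (n : ℕ∞)

/-- The bounded continuous function `f` on `M^n` is the interpretation of the formula `φ`, whose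
free variables are among `x_i`, `i < n`. -/
def Interprets {L : MetricLanguage.{u, v}} {M : Type w} [MetricSpace M] [L.Structure M] {n : ℕ∞}
    (f : Tuple M n →ᵇ ℝ) (φ : Formula L) : Prop :=
  φ.freeVars ⊆ {i | (i : ℕ∞) < n} ∧ ∀ a : ℕ → M, f (fun i => a i) = φ.eval a

/-- Every formula with free variables among `x_i`, `i < n`, has an interpretation. -/
theorem exists_interprets (φ : Formula L) (hφ : φ.freeVars ⊆ {i | (i : ℕ∞) < n}) :
    ∃ f : Tuple M n →ᵇ ℝ, Interprets f φ := by
  classical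
  have : Nonempty M := Structure.nonempty L
  obtain ⟨⟨C, hC⟩, hu⟩ := Formula.bounded_and_uniformContinuous_eval (M := M) φ
  let ext : Tuple M n → ℕ → M := fun a i =>
    if h : (i : ℕ∞) < n then a ⟨i, h⟩ else Classical.arbitrary M
  have hext : Continuous ext := by
    refine continuous_pi fun i => ?_
    by_cases h : (i : ℕ∞) < n
    · simpa [ext, h] using continuous_apply _
    · simpa [ext, h] using continuous_const
  refine ⟨BoundedContinuousFunction.ofNormedAddCommGroup (fun a => φ.eval (ext a))
    (hu.continuous.comp hext) C (fun a => hC _), hφ, fun a => ?_⟩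
  change φ.eval (ext fun i => a i) = φ.eval a
  refine φ.eval_congr fun k hk => ?_
  have : (k : ℕ∞) < n := hφ hk
  simp [ext, this]

/-- The algebra of formulas in the variables `x_i`, `i < n`, two formulas being identified when
they have the same interpretation in `M`, as an algebra of bounded functions on `M^n`. The sup norm
of this algebra is the norm on formulas given by the theory of `M`. -/
def formulaAlgebra : Subalgebra ℝ (Tuple M n →ᵇ ℝ) where
  carrier := {f | ∃ φ : Formula L, Interprets f φ}
  mul_mem' := by
    rintro f g ⟨φ, hφ, hf⟩ ⟨ψ, hψ, hg⟩
    refine ⟨.conn ⟨fun t : Fin 2 → ℝ => t 0 * t 1, by fun_prop⟩ ![φ, ψ], ?_, fun a => ?_⟩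
    · intro i hi
      obtain ⟨j, hj⟩ := Set.mem_iUnion.1 hi
      fin_cases j
      exacts [hφ hj, hψ hj]
    · simp [Formula.eval, hf, hg]
  add_mem' := by
    rintro f g ⟨φ, hφ, hf⟩ ⟨ψ, hψ, hg⟩
    refine ⟨.conn ⟨fun t : Fin 2 → ℝ => t 0 + t 1, by fun_prop⟩ ![φ, ψ], ?_, fun a => ?_⟩
    · intro i hi
      obtain ⟨j, hj⟩ := Set.mem_iUnion.1 hi
      fin_cases j
      exacts [hφ hj, hψ hj]
    · simp [Formula.eval, hf, hg]
  algebraMap_mem' r := by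
    refine ⟨.conn (n := 0) ⟨fun _ => r, by fun_prop⟩ Fin.elim0, ?_, fun a => ?_⟩
    · intro i hi
      obtain ⟨j, hj⟩ := Set.mem_iUnion.1 hi
      exact j.elim0
    · simp [Formula.eval, BoundedContinuousFunction.algebraMap_apply]

/-- The Banach algebra of definable predicates in the variables `x_i`, `i < n`, for the theory
of `M`: the completion of the algebra of formulas, realised as its closure in the complete algebra
of bounded continuous functions on `M^n` (with the sup norm). -/
noncomputable def definablePredicates : Subalgebra ℝ (Tuple M n →ᵇ ℝ) :=
  (L.formulaAlgebra M n).topologicalClosure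

/-- The space `S_n(Th(M))` of `n`-types: the nonzero multiplicative linear functionals of norm at
most `1` on the algebra of definable predicates. -/
def TypeSpace : Type _ :=
  {p : WeakDual.characterSpace ℝ (L.definablePredicates M n) // ∀ φ, ‖p φ‖ ≤ ‖φ‖}

variable {M n}

/-- The type of a tuple `a`: the evaluation `φ ↦ φ(a)` of definable predicates at `a`. -/
noncomputable def tp (a : Tuple M n) : L.TypeSpace M n :=
  ⟨⟨StrongDual.toWeakDual
      ((BoundedContinuousFunction.evalCLM ℝ a).comp
        (L.definablePredicates M n).toSubmodule.subtypeL),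
    by
      intro h
      have h1 := DFunLike.congr_fun h (1 : L.definablePredicates M n)
      exact one_ne_zero (α := ℝ) h1,
    fun _ _ => rfl⟩,
    fun φ => φ.1.norm_coe_le_norm a⟩

theorem tp_apply (a : Tuple M n) (φ : L.definablePredicates M n) :
    (L.tp a).1 φ = φ.1 a := rfl

variable {L} in
theorem Term.eval_smul (g : L.Aut M) (t : Term L) (a : ℕ → M) :
    t.eval (fun i => g • a i) = g • t.eval a := by
  induction t with
  | var k => rfl
  | app f ts ih =>
    simp only [Term.eval, ih]
    exact (g.2.1 f _).symm

variable {L} in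
theorem Formula.eval_smul (g : L.Aut M) (φ : Formula L) : ∀ a : ℕ → M,
    φ.eval (fun i => g • a i) = φ.eval a := by
  have hup : ∀ (a : ℕ → M) (k : ℕ) (b : M), Function.update (fun i => g • a i) k (g • b) =
      fun i => g • Function.update a k b i := by
    intro a k b
    funext i
    by_cases h : i = k
    · subst h; simp
    · simp [h]
  induction φ with
  | rel R ts =>
    intro a
    simp only [Formula.eval, Term.eval_smul]
    exact g.2.2 R _
  | dist s t =>
    intro a
    simp only [Formula.eval, Term.eval_smul]
    exact g.1.dist_eq _ _
  | conn c φ ih =>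
    intro a
    simp only [Formula.eval, ih]
  | inf k φ ih =>
    intro a
    simp only [Formula.eval]
    rw [← (MulAction.toPerm g : Equiv.Perm M).iInf_comp]
    simp only [MulAction.toPerm_apply, hup, ih]
  | sup k φ ih =>
    intro a
    simp only [Formula.eval]
    rw [← (MulAction.toPerm g : Equiv.Perm M).iSup_comp]
    simp only [MulAction.toPerm_apply, hup, ih]

theorem definablePredicates_smul (f : L.definablePredicates M n) (g : L.Aut M)
    (a : Tuple M n) : f.1 (g • a) = f.1 a := by
  have : Nonempty M := Structure.nonempty L
  have hcl : IsClosed {f : Tuple M n →ᵇ ℝ | f (g • a) = f a} :=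
    isClosed_eq (BoundedContinuousFunction.evalCLM ℝ (g • a)).continuous
      (BoundedContinuousFunction.evalCLM ℝ a).continuous
  refine closure_minimal ?_ hcl f.2
  rintro f ⟨φ, hφ, hf⟩
  classical
  let b : ℕ → M := fun i => if h : (i : ℕ∞) < n then a ⟨i, h⟩ else Classical.arbitrary M
  have hb : (fun i : {i : ℕ // (i : ℕ∞) < n} => b i) = a := by
    funext i
    simp [b, i.2]
  have h1 := hf b
  have h2 := hf fun i => g • b i
  rw [Formula.eval_smul, ← h1] at h2
  rw [hb] at h2
  have h3 : g • a = fun i : {i : ℕ // (i : ℕ∞) < n} => g • b i := by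
    rw [← hb]
    rfl
  change f (g • a) = f a
  rw [h3, h2]

theorem tp_eq_of_closure_eq (a b : Tuple M n)
    (h : closure (MulAction.orbit (L.Aut M) a) = closure (MulAction.orbit (L.Aut M) b)) :
    L.tp a = L.tp b := by
  have key : ∀ f : L.definablePredicates M n, f.1 a = f.1 b := by
    intro f
    have hcl : IsClosed {c : Tuple M n | f.1 c = f.1 b} :=
      isClosed_eq f.1.continuous continuous_const
    have ha : a ∈ closure (MulAction.orbit (L.Aut M) b) :=
      h ▸ subset_closure (MulAction.mem_orbit_self a)
    refine closure_minimal ?_ hcl ha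
    rintro _ ⟨g, rfl⟩
    exact L.definablePredicates_smul f g b
  refine Subtype.ext (Subtype.ext ?_)
  exact DFunLike.ext _ _ key

variable (M n) in
/-- The map from orbit closures of `n`-tuples under the automorphism group to `n`-types which sends
the closure of the orbit of `a` to the type of `a`. -/
noncomputable def orbitClosureToType : OrbitClosures (L.Aut M) (Tuple M n) → L.TypeSpace M n :=
  Quotient.lift L.tp fun a b h => L.tp_eq_of_closure_eq a b h

end Types

end MetricLanguage

/-! ### Metric preliminaries. -/

open Filter Topology

/-! Everything rests on compactness: total boundedness of the finite powers modulo G, with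
completeness of M, makes the space of orbit closures in M^ℕ compact (`exists_ultrafilter_limit`).
Hence finitely approximable values of G-invariant continuous functions are attained
(`exists_eq_of_finitely_approximable`), whatever the size of the language. A character of norm at
most 1 is finitely approximable by evaluations, as a sum of squares shows, so it is the type of a
tuple: surjectivity.

Injectivity is approximate homogeneity. Compactness extends an equality of types by one point, up to
a small move of the old coordinates (`TypesAgree.exists_extension`). A back-and-forth with summable
errors then embeds two tuples of the same type, up to a small error, in dense sequences of the same
type, which define an automorphism (`TypesAgree.exists_aut`).

Categoricity is the same back-and-forth between M and a separable model N. Points of N are matched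
in M by compactness. For points of M, compactness and homogeneity give isolation: a formula with a
small value at a tuple of M forces it near a given orbit (`exists_isolating_formula`). The formula
has an approximate witness in N, whose type is realised in M and, by isolation, close to the given
tuple. -/

theorem exists_dist_lt_of_mem_nhds_pi {ι : Type*} {X : ι → Type*} [∀ i, PseudoMetricSpace (X i)]
    {a : ∀ i, X i} {s : Set (∀ i, X i)} (hs : s ∈ 𝓝 a) :
    ∃ I : Set ι, I.Finite ∧ ∃ ε : ℝ, 0 < ε ∧ ∀ x : ∀ i, X i,
      (∀ i ∈ I, dist (x i) (a i) < ε) → x ∈ s := by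
  rw [nhds_pi, Filter.mem_pi] at hs
  obtain ⟨I, hI, t, ht, hts⟩ := hs
  have h : ∀ᶠ ε in 𝓝[>] (0 : ℝ), ∀ i ∈ I, Metric.ball (a i) ε ⊆ t i := by
    refine (eventually_all_finite hI).2 fun i _ => ?_
    obtain ⟨δ, hδ, hb⟩ := Metric.mem_nhds_iff.1 (ht i)
    filter_upwards [Ioc_mem_nhdsGT hδ] with ε hε
    exact (Metric.ball_subset_ball hε.2).trans hb
  obtain ⟨ε, hε, hε0⟩ := (h.and self_mem_nhdsWithin).exists
  exact ⟨I, hI, ε, hε0, fun x hx => hts fun i hi => hε i hi (hx i hi)⟩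

/-- Coordinate i is only controlled once i < m + k, so new coordinates may enter at each stage. From
then on its moves sum to at most δ / 2 ^ k. -/
theorem exists_limit_of_geometric_stages {X : Type*} [MetricSpace X] [CompleteSpace X]
    (z : ℕ → ℕ → X) (m : ℕ) (δ : ℝ)
    (hz : ∀ k i, i < m + k → dist (z k i) (z (k + 1) i) ≤ δ / 2 / 2 ^ k) :
    ∃ b : ℕ → X, (∀ i, Tendsto (fun k => z k i) atTop (𝓝 (b i))) ∧
      ∀ k i, i < m + k → dist (z k i) (b i) ≤ δ / 2 ^ k := by
  have hz' : ∀ k i, i < m + k → ∀ j,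
      dist (z (j + k) i) (z (j + 1 + k) i) ≤ δ / 2 ^ k / 2 / 2 ^ j := by
    intro k i hi j
    have := hz (j + k) i (by omega)
    rw [show j + 1 + k = j + k + 1 by omega]
    refine this.trans_eq ?_
    rw [pow_add]
    field_simp
  have hlim : ∀ i, ∃ b, Tendsto (fun k => z k i) atTop (𝓝 b) := by
    intro i
    have hc := cauchySeq_of_le_geometric_two (hz' (i + 1) i (by omega))
    obtain ⟨b, hb⟩ := cauchySeq_tendsto_of_complete hc
    exact ⟨b, (tendsto_add_atTop_iff_nat (f := fun k => z k i) (i + 1)).1 hb⟩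
  choose b hb using hlim
  refine ⟨b, hb, fun k i hi => ?_⟩
  have := dist_le_of_le_geometric_two_of_tendsto₀ (hz' k i hi)
    ((tendsto_add_atTop_iff_nat (f := fun k => z k i) k).2 (hb i))
  simpa using this

namespace MetricLanguage

/-! ### Compactness of the space of orbit closures. -/

section Compactness

variable {L : MetricLanguage.{u, v}} {M : Type w} [MetricSpace M] [L.Structure M]

instance Aut.instIsIsometricSMul : IsIsometricSMul (L.Aut M) M :=
  ⟨fun g => g.1.isometry⟩

theorem exists_finite_net (hM : IsApproxOligomorphic (L.Aut M) M) (n : ℕ) {ε : ℝ} (hε : 0 < ε) :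
    ∃ F : Set (ℕ → M), F.Finite ∧ ∀ a : ℕ → M, ∃ y ∈ F, ∃ g : L.Aut M,
      ∀ i < n, dist (g • a i) (y i) < ε := by
  have : Nonempty M := Structure.nonempty L
  obtain ⟨F, hF, h⟩ := hM n ε hε
  let e : (Fin n → M) → ℕ → M := fun y i =>
    if h : i < n then y ⟨i, h⟩ else Classical.arbitrary M
  refine ⟨e '' F, hF.image e, fun a => ?_⟩
  obtain ⟨y, hy, hd⟩ := h fun i => a i
  obtain ⟨g, hg⟩ := exists_lt_of_ciInf_lt hd
  refine ⟨e y, Set.mem_image_of_mem e hy, g, fun i hi => ?_⟩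
  have h1 := Finset.single_le_sum
    (f := fun j : Fin n => dist ((g • fun i : Fin n => a i) j) (y j))
    (fun j _ => dist_nonneg) (Finset.mem_univ ⟨i, hi⟩)
  have h2 : e y i = y ⟨i, hi⟩ := by simp [e, hi]
  rw [h2]
  exact h1.trans_lt hg

/-- The space of orbit closures of sequences is compact. -/
theorem exists_ultrafilter_limit (hM : IsApproxOligomorphic (L.Aut M) M)
    (U : Ultrafilter (ℕ → M)) : ∃ b : ℕ → M, ∀ (n : ℕ) (ε : ℝ), 0 < ε →
      ∀ᶠ a in (U : Filter (ℕ → M)), ∃ g : L.Aut M, ∀ i < n, dist (g • a i) (b i) < ε := by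
  have : CompleteSpace M := Structure.complete L
  have hy : ∀ k : ℕ, ∃ y : ℕ → M, ∀ᶠ a in (U : Filter (ℕ → M)), ∃ g : L.Aut M,
      ∀ i < k, dist (g • a i) (y i) < 1 / 2 ^ k := by
    intro k
    obtain ⟨F, hF, h⟩ := exists_finite_net hM k (ε := 1 / 2 ^ k) (by positivity)
    -- The translates of finitely many balls cover everything, so the ultrafilter selects one of
    -- them.
    have := (Ultrafilter.finite_biUnion_mem_iff (f := U) (s := fun y : ℕ → M =>
      {a | ∃ g : L.Aut M, ∀ i < k, dist (g • a i) (y i) < 1 / 2 ^ k}) hF).1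
      (univ_mem' fun a => by simpa using h a)
    obtain ⟨y, _, hy⟩ := this
    exact ⟨y, hy⟩
  choose y hy using hy
  -- One sequence a has translates close to both centres, so these are close modulo G. The bound 4 /
  -- 2 / 2 ^ k is 2 / 2 ^ k in the form required by the limit lemma with δ = 4.
  have hγ : ∀ k, ∃ γ : L.Aut M, ∀ i < k, dist (y k i) (γ • y (k + 1) i) ≤ 4 / 2 / 2 ^ k := by
    intro k
    obtain ⟨a, ⟨g, hg⟩, h, hh⟩ := ((hy k).and (hy (k + 1))).exists
    refine ⟨g * h⁻¹, fun i hi => ?_⟩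
    have h1 := hg i hi
    have h2 := hh i (by omega)
    rw [← dist_smul (g * h⁻¹), mul_smul, inv_smul_smul] at h2
    have h3 := dist_triangle_left (y k i) ((g * h⁻¹) • y (k + 1) i) (g • a i)
    have h4 : (1 : ℝ) / 2 ^ (k + 1) ≤ 1 / 2 ^ k := by
      gcongr <;> norm_num
    have h5 : (4 : ℝ) / 2 / 2 ^ k = 1 / 2 ^ k + 1 / 2 ^ k := by ring
    linarith
  choose γ hγ using hγ
  -- The partial products of the γ k align all the centres successively: t k • y k converges
  -- coordinatewise.
  let t : ℕ → L.Aut M := fun k => Nat.rec 1 (fun k g => g * γ k) k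
  obtain ⟨b, -, hb⟩ := exists_limit_of_geometric_stages (fun k i => t k • y k i) 0 4 (by
    intro k i hi
    change dist (t k • y k i) ((t k * γ k) • y (k + 1) i) ≤ _
    rw [mul_smul, dist_smul]
    exact hγ k i (by omega))
  refine ⟨b, fun n ε hε => ?_⟩
  obtain ⟨k, hk⟩ := exists_pow_lt_of_lt_one (show 0 < ε / 5 by positivity)
    (show (1 / 2 : ℝ) < 1 by norm_num)
  -- Here 5 = 1 + 4: the radius of the ball plus the distance from the moved centre to the limit.
  have hk' : (5 : ℝ) / 2 ^ (max n k) < ε := by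
    have h1 : (1 / 2 : ℝ) ^ (max n k) ≤ (1 / 2) ^ k :=
      pow_le_pow_of_le_one (by norm_num) (by norm_num) (le_max_right _ _)
    rw [one_div_pow] at h1
    rw [div_eq_mul_one_div]
    linarith
  filter_upwards [hy (max n k)] with a ⟨g, hg⟩
  refine ⟨t (max n k) * g, fun i hi => ?_⟩
  have hi' : i < max n k := hi.trans_le (le_max_left _ _)
  have h1 := hg i hi'
  have h2 := hb (max n k) i (by omega)
  rw [← dist_smul (t (max n k)), ← mul_smul] at h1
  have h3 := dist_triangle ((t (max n k) * g) • a i) (t (max n k) • y (max n k) i) (b i)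
  have h5 : (5 : ℝ) / 2 ^ (max n k) = 1 / 2 ^ (max n k) + 4 / 2 ^ (max n k) := by ring
  linarith

/-- Prescribed values of invariant continuous functions which are finitely approximable in `S` are
attained at a point whose orbit is approximated by points of `S`. -/
theorem exists_eq_of_finitely_approximable (hM : IsApproxOligomorphic (L.Aut M) M) {ι : Type*}
    (f : ι → (ℕ → M) → ℝ) (hf : ∀ i, Continuous (f i))
    (hG : ∀ i (g : L.Aut M) (a : ℕ → M), f i (g • a) = f i a) (r : ι → ℝ) (S : Set (ℕ → M))
    (H : ∀ (s : Finset ι) (ε : ℝ), 0 < ε → ∃ a ∈ S, ∀ i ∈ s, |f i a - r i| < ε) :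
    ∃ x : ℕ → M, (∀ i, f i x = r i) ∧ ∀ (n : ℕ) (ε : ℝ), 0 < ε →
      ∃ a ∈ S, ∃ g : L.Aut M, ∀ i < n, dist (g • a i) (x i) < ε := by
  let Φ : (ℕ → M) → ι → ℝ := fun a i => f i a
  have hcl : r ∈ closure (Φ '' S) := by
    rw [mem_closure_iff_nhds]
    intro t ht
    obtain ⟨I, hI, ε, hε, h⟩ := exists_dist_lt_of_mem_nhds_pi ht
    obtain ⟨a, ha, h'⟩ := H hI.toFinset ε hε
    exact ⟨Φ a, h _ fun i hi => h' i (hI.mem_toFinset.2 hi), a, ha, rfl⟩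
  -- Finite approximability gives an ultrafilter on S along which each f i tends to r i; its limit
  -- modulo G is the required point.
  have hne : NeBot (comap Φ (𝓝 r) ⊓ 𝓟 S) := by
    rw [neBot_inf_comap_iff_map', map_principal]
    exact mem_closure_iff_clusterPt.1 hcl
  let U := Ultrafilter.of (comap Φ (𝓝 r) ⊓ 𝓟 S)
  have hU := Ultrafilter.of_le (comap Φ (𝓝 r) ⊓ 𝓟 S)
  obtain ⟨x, hx⟩ := exists_ultrafilter_limit hM U
  refine ⟨x, fun i => ?_, fun n ε hε => ?_⟩
  · have h1 : Tendsto (f i) U (𝓝 (r i)) :=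
      (tendsto_pi_nhds.1 (tendsto_comap.mono_left (hU.trans inf_le_left))) i
    refine tendsto_nhds_unique (f := f i) (l := (U : Filter (ℕ → M))) ?_ h1
    intro V hV
    obtain ⟨I, hI, ε, hε, h⟩ := exists_dist_lt_of_mem_nhds_pi ((hf i).continuousAt hV)
    obtain ⟨m, hm⟩ := hI.bddAbove
    change ∀ᶠ a in (U : Filter (ℕ → M)), f i a ∈ V
    filter_upwards [hx (m + 1) ε hε] with a ⟨g, hg⟩
    -- Only a translate of a is near x, but invariance of f i makes this enough.
    have := h (g • a) fun j hj => hg j (Nat.lt_succ_of_le (hm hj))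
    rwa [Set.mem_preimage, hG] at this
  · have hS : ∀ᶠ a in (U : Filter (ℕ → M)), a ∈ S := (hU.trans inf_le_right) (mem_principal_self S)
    obtain ⟨a, ha, hg⟩ := (hS.and (hx n ε hε)).exists
    exact ⟨a, ha, hg⟩

end Compactness

end MetricLanguage

/-- Both spaces are completions of ι for the pseudometric pulled back along `a`, which by `h` is
also the one pulled back along `b`. -/
theorem exists_isometryEquiv_of_denseRange {ι X Y : Type*} [MetricSpace X] [MetricSpace Y]
    [CompleteSpace X] [CompleteSpace Y] {a : ι → X} {b : ι → Y} (ha : DenseRange a)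
    (hb : DenseRange b) (h : ∀ i j, dist (b i) (b j) = dist (a i) (a j)) :
    ∃ e : X ≃ᵢ Y, ∀ i, e (a i) = b i := by
  let := PseudoMetricSpace.induced a inferInstance
  have hia : Isometry a := Isometry.of_dist_eq fun _ _ => rfl
  have hib : Isometry b := Isometry.of_dist_eq h
  let A : AbstractCompletion ι :=
    ⟨X, a, inferInstance, inferInstance, inferInstance, hia.isUniformInducing, ha⟩
  let B : AbstractCompletion ι :=
    ⟨Y, b, inferInstance, inferInstance, inferInstance, hib.isUniformInducing, hb⟩
  let E : X ≃ᵤ Y := A.compareEquiv B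
  have hE : ∀ i, E (a i) = b i := fun i => A.compare_coe B i
  refine ⟨⟨E.toEquiv, Isometry.of_dist_eq fun x y => ?_⟩, hE⟩
  refine ha.induction_on₂ (p := fun x y => dist (E x) (E y) = dist x y) ?_ ?_ x y
  · exact isClosed_eq ((E.continuous.comp continuous_fst).dist (E.continuous.comp continuous_snd))
      (continuous_fst.dist continuous_snd)
  · intro i j
    rw [hE, hE]
    exact h i j

namespace MetricLanguage

/-! ### Equality of types and one-point extensions. -/

section Agreement

variable {L : MetricLanguage.{u, v}}

theorem Term.finite_freeVars (t : Term L) : t.freeVars.Finite := by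
  induction t with
  | var k => exact Set.finite_singleton k
  | app f ts ih => exact Set.finite_iUnion ih

theorem Formula.finite_freeVars (φ : Formula L) : φ.freeVars.Finite := by
  induction φ with
  | rel R ts => exact Set.finite_iUnion fun i => (ts i).finite_freeVars
  | dist s t => exact s.finite_freeVars.union t.finite_freeVars
  | conn c φ ih => exact Set.finite_iUnion ih
  | inf k φ ih => exact ih.sdiff
  | sup k φ ih => exact ih.sdiff

theorem Formula.exists_freeVars_subset_Iio (φ : Formula L) : ∃ m, φ.freeVars ⊆ Set.Iio m := by
  obtain ⟨m, hm⟩ := φ.finite_freeVars.bddAbove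
  exact ⟨m + 1, fun i hi => Nat.lt_succ_of_le (hm hi)⟩

/-- The formula `∑ |φ - r φ|`, where `φ` ranges over a finite set of formulas. -/
noncomputable def Formula.sumAbsSub (s : Finset (Formula L)) (r : Formula L → ℝ) : Formula L :=
  .conn (n := s.card) ⟨fun t => ∑ i, |t i - r (s.equivFin.symm i)|, by fun_prop⟩
    fun i => s.equivFin.symm i

theorem Formula.eval_sumAbsSub {M : Type w} [MetricSpace M] [L.Structure M]
    (s : Finset (Formula L)) (r : Formula L → ℝ) (a : ℕ → M) :
    (Formula.sumAbsSub s r).eval a = ∑ φ ∈ s, |φ.eval a - r φ| := by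
  simp only [Formula.sumAbsSub, Formula.eval, ContinuousMap.coe_mk]
  rw [← Finset.sum_coe_sort s]
  exact Equiv.sum_comp s.equivFin.symm fun φ : s => |φ.1.eval a - r φ|

theorem Formula.freeVars_sumAbsSub_subset {s : Finset (Formula L)} {r : Formula L → ℝ} {V : Set ℕ}
    (h : ∀ φ ∈ s, φ.freeVars ⊆ V) : (Formula.sumAbsSub s r).freeVars ⊆ V :=
  Set.iUnion_subset fun i => h _ (s.equivFin.symm i).2

variable {M : Type w₁} {N : Type w₂} [MetricSpace M] [MetricSpace N] [L.Structure M]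
  [L.Structure N]

variable (L) in
/-- The first `n` terms of the sequences `a` and `b` have the same type: all formulas in the first
`n` variables have the same value at `a` and `b`. -/
def TypesAgree (n : ℕ) (a : ℕ → M) (b : ℕ → N) : Prop :=
  ∀ φ : Formula L, φ.freeVars ⊆ Set.Iio n → φ.eval a = φ.eval b

theorem TypesAgree.symm {n : ℕ} {a : ℕ → M} {b : ℕ → N} (h : L.TypesAgree n a b) :
    L.TypesAgree n b a := fun φ hφ => (h φ hφ).symm

/-- The infimum over the last variable is a formula in the first n variables, so its value
transfers; as it need not be attained, only an approximate witness results. -/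
theorem TypesAgree.exists_eval_update_lt {n : ℕ} {a : ℕ → M} {b : ℕ → N}
    (h : L.TypesAgree n a b) {φ : Formula L} (hφ : φ.freeVars ⊆ Set.Iio (n + 1)) {c : M} {ε : ℝ}
    (hc : φ.eval (Function.update a n c) < ε) : ∃ d : N, φ.eval (Function.update b n d) < ε := by
  have : Nonempty N := Structure.nonempty L
  obtain ⟨⟨C, hC⟩, -⟩ := Formula.bounded_and_uniformContinuous_eval (M := M) φ
  have h1 : (Formula.inf n φ).eval a < ε :=
    (ciInf_le ⟨-C, by rintro _ ⟨x, rfl⟩; exact (abs_le.1 (hC _)).1⟩ c).trans_lt hc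
  rw [h (Formula.inf n φ) fun i hi => lt_of_le_of_ne (Nat.le_of_lt_succ (hφ hi.1)) hi.2] at h1
  exact exists_lt_of_ciInf_lt h1

theorem Formula.finset_abs_sub_lt {s : Finset (Formula L)} {r : Formula L → ℝ} {a : ℕ → M} {ε : ℝ}
    (h : (Formula.sumAbsSub s r).eval a < ε) : ∀ φ ∈ s, |φ.eval a - r φ| < ε := by
  rw [Formula.eval_sumAbsSub] at h
  exact fun φ hφ => (Finset.single_le_sum (f := fun φ : Formula L => |φ.eval a - r φ|)
    (fun _ _ => abs_nonneg _) hφ).trans_lt h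

/-- A type which is finitely approximable in a set `S` of sequences is realised by a sequence whose
orbit is approximated by elements of `S`. -/
theorem exists_typesAgree_of_approximable (hM : IsApproxOligomorphic (L.Aut M) M) {n : ℕ}
    (a : ℕ → N) (S : Set (ℕ → M))
    (H : ∀ φ : Formula L, φ.freeVars ⊆ Set.Iio n → φ.eval a = 0 → ∀ ε : ℝ, 0 < ε →
      ∃ x ∈ S, φ.eval x < ε) :
    ∃ x : ℕ → M, L.TypesAgree n a x ∧ ∀ (m : ℕ) (ε : ℝ), 0 < ε →
      ∃ y ∈ S, ∃ g : L.Aut M, ∀ i < m, dist (g • y i) (x i) < ε := by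
  obtain ⟨x, hx, hS⟩ := exists_eq_of_finitely_approximable hM
    (ι := {φ : Formula L // φ.freeVars ⊆ Set.Iio n}) (fun φ x => φ.1.eval x)
    (fun φ => φ.1.bounded_and_uniformContinuous_eval.2.continuous)
    (fun φ g a => φ.1.eval_smul g a) (fun φ => φ.1.eval a) S (by
      intro s ε hε
      -- Finitely many conditions become one formula vanishing at a, to which H applies.
      let ψ := Formula.sumAbsSub (s.map (Function.Embedding.subtype _)) fun φ => φ.eval a
      obtain ⟨x, hxS, hx⟩ := H ψ (Formula.freeVars_sumAbsSub_subset (by simp +contextual))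
        (by simp [ψ, Formula.eval_sumAbsSub]) ε hε
      exact ⟨x, hxS, fun φ hφ => Formula.finset_abs_sub_lt hx φ.1
        (Finset.mem_map_of_mem (Function.Embedding.subtype _) hφ)⟩)
  exact ⟨x, fun φ hφ => (hx ⟨φ, hφ⟩).symm, hS⟩

theorem TypesAgree.smul_right {n : ℕ} {a : ℕ → M} {b : ℕ → N} (h : L.TypesAgree n a b)
    (g : L.Aut N) : L.TypesAgree n a (g • b) := fun φ hφ =>
  (h φ hφ).trans (φ.eval_smul g b).symm

/-- The type of (a, c) is approximable among the sequences extending b. Its realisation is only a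
limit of translates of such sequences, so translating it back moves b by less than ε. -/
theorem TypesAgree.exists_extension (hM : IsApproxOligomorphic (L.Aut M) M) {n : ℕ} {a : ℕ → N}
    {b : ℕ → M} (h : L.TypesAgree n a b) (c : N) {ε : ℝ} (hε : 0 < ε) :
    ∃ b' : ℕ → M, (∀ i < n, dist (b i) (b' i) < ε) ∧
      L.TypesAgree (n + 1) (Function.update a n c) b' := by
  obtain ⟨x, hx, hS⟩ := exists_typesAgree_of_approximable hM (n := n + 1) (Function.update a n c)
    {x | ∀ i < n, x i = b i} (by
      intro φ hφ h0 ε hε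
      obtain ⟨d, hd⟩ := h.exists_eval_update_lt hφ (h0.trans_lt hε)
      exact ⟨_, fun i hi => Function.update_of_ne hi.ne _ _, hd⟩)
  obtain ⟨y, hy, g, hg⟩ := hS n ε hε
  refine ⟨g⁻¹ • x, fun i hi => ?_, hx.smul_right g⁻¹⟩
  have := hg i hi
  rw [hy i hi] at this
  rwa [← dist_smul g, Pi.smul_apply, smul_inv_smul]

end Agreement

/-! ### Back-and-forth with errors. -/

section BackAndForth

variable {L : MetricLanguage.{u, v}} {M : Type w₁} {N : Type w₂} [MetricSpace M] [MetricSpace N]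
  [L.Structure M] [L.Structure N]

/-- Stage k adds one coordinate near a prescribed point of M or N and moves the old ones by less
than ε / 2 / 2 ^ k. Density survives in the limit because each target recurs at stages with
arbitrarily small error. -/
theorem exists_dense_of_extension [TopologicalSpace.SeparableSpace M]
    [TopologicalSpace.SeparableSpace N]
    (h₁ : ∀ (n : ℕ) (a : ℕ → M) (b : ℕ → N), L.TypesAgree n a b → ∀ (c : M) (ε : ℝ), 0 < ε →
      ∃ (a' : ℕ → M) (b' : ℕ → N), L.TypesAgree (n + 1) a' b' ∧ (∀ i < n, dist (a i) (a' i) < ε) ∧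
        (∀ i < n, dist (b i) (b' i) < ε) ∧ dist c (a' n) < ε)
    (h₂ : ∀ (n : ℕ) (a : ℕ → M) (b : ℕ → N), L.TypesAgree n a b → ∀ (d : N) (ε : ℝ), 0 < ε →
      ∃ (a' : ℕ → M) (b' : ℕ → N), L.TypesAgree (n + 1) a' b' ∧ (∀ i < n, dist (a i) (a' i) < ε) ∧
        (∀ i < n, dist (b i) (b' i) < ε) ∧ dist d (b' n) < ε)
    {n : ℕ} {a : ℕ → M} {b : ℕ → N} (h : L.TypesAgree n a b) {ε : ℝ} (hε : 0 < ε) :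
    ∃ (a' : ℕ → M) (b' : ℕ → N), DenseRange a' ∧ DenseRange b' ∧
      (∀ φ : Formula L, φ.eval a' = φ.eval b') ∧ (∀ i < n, dist (a i) (a' i) ≤ ε) ∧
      ∀ i < n, dist (b i) (b' i) ≤ ε := by
  have : Nonempty M := Structure.nonempty L
  have : CompleteSpace M := Structure.complete L
  have : CompleteSpace N := Structure.complete L
  -- One enumeration serves both sides, and the first component of `unpair` takes each value
  -- infinitely often.
  let t : ℕ → M ⊕ N := fun k => TopologicalSpace.denseSeq (M ⊕ N) k.unpair.1
  let P : ℕ → Type _ := fun k => {p : (ℕ → M) × (ℕ → N) // L.TypesAgree (n + k) p.1 p.2}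
  have step : ∀ (k : ℕ) (p : P k), ∃ q : P (k + 1),
      (∀ i < n + k, dist (p.1.1 i) (q.1.1 i) < ε / 2 / 2 ^ k) ∧
      (∀ i < n + k, dist (p.1.2 i) (q.1.2 i) < ε / 2 / 2 ^ k) ∧
      (∀ c, t k = Sum.inl c → dist c (q.1.1 (n + k)) < ε / 2 / 2 ^ k) ∧
      (∀ d, t k = Sum.inr d → dist d (q.1.2 (n + k)) < ε / 2 / 2 ^ k) := by
    intro k p
    rcases htk : t k with c | d
    · obtain ⟨a', b', h, ha, hb, hc⟩ := h₁ _ _ _ p.2 c (ε / 2 / 2 ^ k) (by positivity)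
      exact ⟨⟨(a', b'), h⟩, ha, hb, fun _ h => Sum.inl.inj h ▸ hc, fun _ h => by simp at h⟩
    · obtain ⟨a', b', h, ha, hb, hc⟩ := h₂ _ _ _ p.2 d (ε / 2 / 2 ^ k) (by positivity)
      exact ⟨⟨(a', b'), h⟩, ha, hb, fun _ h => by simp at h, fun _ h => Sum.inr.inj h ▸ hc⟩
  choose next hn₁ hn₂ hn₃ hn₄ using step
  let s : ∀ k, P k := fun k => Nat.rec ⟨(a, b), h⟩ (fun k p => next k p) k
  obtain ⟨a', ha', hda⟩ := exists_limit_of_geometric_stages (fun k => (s k).1.1) n ε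
    fun k i hi => (hn₁ k (s k) i hi).le
  obtain ⟨b', hb', hdb⟩ := exists_limit_of_geometric_stages (fun k => (s k).1.2) n ε
    fun k i hi => (hn₂ k (s k) i hi).le
  have small : ∀ (j : ℕ) (η : ℝ), 0 < η → ∃ k, t k = TopologicalSpace.denseSeq (M ⊕ N) j ∧
      ε / 2 / 2 ^ k + ε / 2 ^ (k + 1) < η := by
    intro j η hη
    obtain ⟨m, hm⟩ := exists_pow_lt_of_lt_one (show 0 < η / ε by positivity)
      (show (1 / 2 : ℝ) < 1 by norm_num)
    refine ⟨Nat.pair j m, by simp [t], ?_⟩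
    have h1 : (1 / 2 : ℝ) ^ Nat.pair j m ≤ (1 / 2) ^ m :=
      pow_le_pow_of_le_one (by norm_num) (by norm_num) (Nat.right_le_pair j m)
    have h2 := (lt_div_iff₀ hε).1 (h1.trans_lt hm)
    refine lt_of_eq_of_lt ?_ h2
    rw [one_div_pow, pow_succ]
    field_simp
    norm_num
  refine ⟨a', b', ?_, ?_, fun φ => ?_, fun i hi => ?_, fun i hi => ?_⟩
  · refine Metric.denseRange_iff.2 fun x η hη => ?_
    obtain ⟨j, c, hc, hj⟩ := (TopologicalSpace.denseRange_denseSeq (M ⊕ N)).exists_mem_open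
      (isOpenMap_inl (X := M) (Y := N) _ (Metric.isOpen_ball (x := x) (ε := η / 2)))
      ⟨_, x, Metric.mem_ball_self (half_pos hη), rfl⟩
    obtain ⟨k, hk, hkη⟩ := small j (η / 2) (half_pos hη)
    have h1 := hn₃ k (s k) c (hk.trans hj.symm)
    have h2 := hda (k + 1) (n + k) (by omega)
    have h3 := dist_triangle4 x c ((s (k + 1)).1.1 (n + k)) (a' (n + k))
    rw [Metric.mem_ball'] at hc
    exact ⟨n + k, by linarith⟩
  · refine Metric.denseRange_iff.2 fun x η hη => ?_
    obtain ⟨j, d, hd, hj⟩ := (TopologicalSpace.denseRange_denseSeq (M ⊕ N)).exists_mem_open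
      (isOpenMap_inr (X := M) (Y := N) _ (Metric.isOpen_ball (x := x) (ε := η / 2)))
      ⟨_, x, Metric.mem_ball_self (half_pos hη), rfl⟩
    obtain ⟨k, hk, hkη⟩ := small j (η / 2) (half_pos hη)
    have h1 := hn₄ k (s k) d (hk.trans hj.symm)
    have h2 := hdb (k + 1) (n + k) (by omega)
    have h3 := dist_triangle4 x d ((s (k + 1)).1.2 (n + k)) (b' (n + k))
    rw [Metric.mem_ball'] at hd
    exact ⟨n + k, by linarith⟩
  · have hφM := φ.bounded_and_uniformContinuous_eval (M := M).2.continuous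
    have hφN := φ.bounded_and_uniformContinuous_eval (M := N).2.continuous
    obtain ⟨m, hm⟩ := φ.exists_freeVars_subset_Iio
    -- A formula has finitely many free variables, so its values agree at all late stages;
    -- continuity passes this to the limit.
    refine tendsto_nhds_unique_of_eventuallyEq ((hφM.tendsto a').comp (tendsto_pi_nhds.2 ha'))
      ((hφN.tendsto b').comp (tendsto_pi_nhds.2 hb')) ?_
    filter_upwards [eventually_ge_atTop m] with k hk
    exact (s k).2 φ (hm.trans (Set.Iio_subset_Iio (by omega)))
  · simpa [s] using hda 0 i (by omega)
  · simpa [s] using hdb 0 i (by omega)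

theorem exists_isometryEquiv_of_dense {a : ℕ → M} {b : ℕ → N} (ha : DenseRange a)
    (hb : DenseRange b) (h : ∀ φ : Formula L, φ.eval a = φ.eval b) :
    ∃ e : M ≃ᵢ N, L.Preserves e ∧ ∀ i, e (a i) = b i := by
  have : CompleteSpace M := Structure.complete L
  have : CompleteSpace N := Structure.complete L
  have hd : ∀ s t : Term L, dist (s.eval a) (t.eval a) = dist (s.eval b) (t.eval b) :=
    fun s t => h (.dist s t)
  obtain ⟨E, hE⟩ := exists_isometryEquiv_of_denseRange ha hb
    fun i j => (hd (.var i) (.var j)).symm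
  -- Both points have the same distance to every b j, and these are dense.
  have hterm : ∀ t : Term L, E (t.eval a) = t.eval b := by
    intro t
    refine dist_eq_zero.1 ?_
    have hcl : IsClosed {y : N | dist (E (t.eval a)) y = dist (t.eval b) y} :=
      isClosed_eq (by fun_prop) (by fun_prop)
    have := isClosed_property hb hcl (fun j => by
      rw [← hE j, E.dist_eq, hE j]
      exact hd t (.var j)) (t.eval b)
    rw [this, dist_self]
  refine ⟨E, ⟨fun f x => ?_, fun R x => ?_⟩, hE⟩
  · have c₁ : Continuous (Structure.funMap f : _ → M) := (uniformContinuous_of_modulus _ _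
      (L.funModulus_pos f) (Structure.funMap_modulus f)).continuous
    have c₂ : Continuous (Structure.funMap f : _ → N) := (uniformContinuous_of_modulus _ _
      (L.funModulus_pos f) (Structure.funMap_modulus f)).continuous
    refine isClosed_property (DenseRange.piMap fun _ => ha)
      (isClosed_eq (E.continuous.comp c₁)
        (c₂.comp (continuous_pi fun i => E.continuous.comp (continuous_apply i)))) (fun j => ?_) x
    change E (Structure.funMap f fun i => a (j i)) = Structure.funMap f fun i => E (a (j i))
    simp only [hE]
    exact hterm (.app f fun i => .var (j i))
  · have c₁ : Continuous (Structure.relMap R : (_ → M) → ℝ) := (uniformContinuous_of_modulus _ _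
      (L.relModulus_pos R) (Structure.relMap_modulus R)).continuous
    have c₂ : Continuous (Structure.relMap R : (_ → N) → ℝ) := (uniformContinuous_of_modulus _ _
      (L.relModulus_pos R) (Structure.relMap_modulus R)).continuous
    refine isClosed_property (DenseRange.piMap fun _ => ha)
      (isClosed_eq (c₂.comp (continuous_pi fun i => E.continuous.comp (continuous_apply i))) c₁)
      (fun j => ?_) x
    change Structure.relMap R (fun i => E (a (j i))) = Structure.relMap R fun i => a (j i)
    simp only [hE]
    exact (h (.rel R fun i => .var (j i))).symm

end BackAndForth

end MetricLanguage

theorem exists_extend_tuple {X : Type*} [Nonempty X] {n : ℕ∞} (a : Tuple X n) :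
    ∃ b : ℕ → X, (fun i : {i : ℕ // (i : ℕ∞) < n} => b i) = a := by
  classical
  exact ⟨fun i => if h : (i : ℕ∞) < n then a ⟨i, h⟩ else Classical.arbitrary X,
    funext fun i => by simp [i.2]⟩

namespace MetricLanguage

/-! ### Homogeneity, isolation of types and categoricity. -/

section Homogeneity

variable {L : MetricLanguage.{u, v}} {M : Type w₁} {N : Type w₂} [MetricSpace M] [MetricSpace N]
  [L.Structure M] [L.Structure N]

theorem dist_update_of_lt {X : Type*} [PseudoMetricSpace X] {n : ℕ} (a : ℕ → X) (c : X) {ε : ℝ}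
    (hε : 0 < ε) : ∀ i < n, dist (a i) (Function.update a n c i) < ε := fun i hi => by
  rwa [Function.update_of_ne hi.ne, dist_self]

/-- Back-and-forth of M with itself: each tuple moves by at most ε / 3, and the automorphism matches
the limits exactly. -/
theorem TypesAgree.exists_aut (hM : IsApproxOligomorphic (L.Aut M) M)
    [TopologicalSpace.SeparableSpace M] {n : ℕ} {a b : ℕ → M} (h : L.TypesAgree n a b) {ε : ℝ}
    (hε : 0 < ε) : ∃ g : L.Aut M, ∀ i < n, dist (g • a i) (b i) < ε := by
  obtain ⟨a', b', ha, hb, hφ, hda, hdb⟩ := exists_dense_of_extension (L := L) (M := M) (N := M)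
    (fun n a b h c ε hε => by
      obtain ⟨b', hb', h'⟩ := h.exists_extension hM c hε
      exact ⟨_, b', h', dist_update_of_lt a c hε, hb', by simpa using hε⟩)
    (fun n a b h d ε hε => by
      obtain ⟨a', ha', h'⟩ := h.symm.exists_extension hM d hε
      exact ⟨a', _, h'.symm, ha', dist_update_of_lt b d hε, by simpa using hε⟩)
    h (ε := ε / 3) (by positivity)
  obtain ⟨e, he, hab⟩ := exists_isometryEquiv_of_dense ha hb hφ
  let g : L.Aut M := ⟨e, he⟩
  refine ⟨g, fun i hi => ?_⟩
  have h1 := hda i hi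
  have h2 := hdb i hi
  rw [← dist_smul g, show g • a' i = b' i from hab i] at h1
  rw [dist_comm] at h2
  have h3 := dist_triangle (g • a i) (b' i) (b i)
  linarith

/-- Types are isolated: formulas define a basis of neighbourhoods of an orbit closure. -/
theorem exists_isolating_formula (hM : IsApproxOligomorphic (L.Aut M) M)
    [TopologicalSpace.SeparableSpace M] (n : ℕ) (e : ℕ → M) {ε : ℝ} (hε : 0 < ε) :
    ∃ φ : Formula L, φ.freeVars ⊆ Set.Iio n ∧ φ.eval e = 0 ∧ ∃ δ : ℝ, 0 < δ ∧
      ∀ x : ℕ → M, φ.eval x < δ → ∃ g : L.Aut M, ∀ i < n, dist (g • x i) (e i) < ε := by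
  by_contra! hcon
  -- Otherwise the type of e is approximable among sequences with no translate near e. A realisation
  -- x is near a translate of such a sequence, yet homogeneity brings x near e.
  obtain ⟨x, hx, hS⟩ := exists_typesAgree_of_approximable hM (n := n) e
    {x | ∀ g : L.Aut M, ∃ i < n, ε ≤ dist (g • x i) (e i)} fun φ hφ h0 δ hδ => by
      obtain ⟨x, hx, h⟩ := hcon φ hφ h0 δ hδ
      exact ⟨x, h, hx⟩
  obtain ⟨y, hy, g, hg⟩ := hS n (ε / 2) (by positivity)
  obtain ⟨h, hh⟩ := hx.symm.exists_aut hM (ε := ε / 2) (by positivity)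
  obtain ⟨i, hi, hle⟩ := hy (h * g)
  have h1 := hg i hi
  have h2 := hh i hi
  rw [← dist_smul h, ← mul_smul] at h1
  have h3 := dist_triangle ((h * g) • y i) (h • x i) (e i)
  linarith

/-- Compactness is available only in M: an isolating formula for (a, c) gets an approximate witness
d in N, the type of (b, d) is realised in M, and isolation moves the realisation near (a, c). -/
theorem TypesAgree.exists_extension_left (hM : IsApproxOligomorphic (L.Aut M) M)
    [TopologicalSpace.SeparableSpace M] {n : ℕ} {a : ℕ → M} {b : ℕ → N} (h : L.TypesAgree n a b)
    (c : M) {ε : ℝ} (hε : 0 < ε) : ∃ (a' : ℕ → M) (d : N),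
      (∀ i < n, dist (a i) (a' i) < ε) ∧ dist c (a' n) < ε ∧
        L.TypesAgree (n + 1) a' (Function.update b n d) := by
  obtain ⟨φ, hφ, h0, δ, hδ, hiso⟩ :=
    exists_isolating_formula hM (n + 1) (Function.update a n c) hε
  obtain ⟨d, hd⟩ := h.exists_eval_update_lt hφ (h0.trans_lt hδ)
  obtain ⟨x, -, hx⟩ := h.symm.exists_extension hM d hε
  rw [hx φ hφ] at hd
  obtain ⟨g, hg⟩ := hiso x hd
  refine ⟨g • x, d, fun i hi => ?_, ?_, (hx.smul_right g).symm⟩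
  · have := hg i (by omega)
    rwa [Function.update_of_ne hi.ne, dist_comm] at this
  · have := hg n (by omega)
    rwa [Function.update_self, dist_comm] at this

theorem typesAgree_zero_of_isModel (hN : IsModel (L.Th M) N) (a : ℕ → M) (b : ℕ → N) :
    L.TypesAgree 0 a b := by
  intro φ hφ
  have hφ' : φ.freeVars = ∅ := by simpa using hφ
  -- The theory records only sentences of value 0; subtracting the constant value makes it determine
  -- all values.
  let ψ : Formula L := .conn (n := 1) ⟨fun t => t 0 - φ.eval a, by fun_prop⟩ fun _ => φ
  have hψ : ψ.freeVars = ∅ := Set.iUnion_eq_empty.2 fun _ => hφ'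
  have hmem : (⟨ψ, hψ⟩ : Sentence L) ∈ L.Th M := fun a' => by
    simp [ψ, Formula.eval, φ.eval_congr (a := a') (b := a) (by simp [hφ'])]
  have h := hN hmem b
  simp only [ψ, Formula.eval, ContinuousMap.coe_mk] at h
  linarith

theorem isomorphic_of_isModel (hM : IsApproxOligomorphic (L.Aut M) M)
    [TopologicalSpace.SeparableSpace M] [TopologicalSpace.SeparableSpace N]
    (hN : IsModel (L.Th M) N) : L.Isomorphic M N := by
  have : Nonempty M := Structure.nonempty L
  have : Nonempty N := Structure.nonempty L
  obtain ⟨a, b, ha, hb, hφ, -, -⟩ := exists_dense_of_extension (L := L) (M := M) (N := N)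
    (fun n a b h c ε hε => by
      obtain ⟨a', d, ha', hc, h'⟩ := h.exists_extension_left hM c hε
      exact ⟨a', _, h', ha', dist_update_of_lt b d hε, hc⟩)
    (fun n a b h d ε hε => by
      obtain ⟨a', ha', h'⟩ := h.symm.exists_extension hM d hε
      exact ⟨a', _, h'.symm, ha', dist_update_of_lt b d hε, by simpa using hε⟩)
    (typesAgree_zero_of_isModel hN (fun _ => Classical.arbitrary M) fun _ => Classical.arbitrary N)
    one_pos
  obtain ⟨e, he, -⟩ := exists_isometryEquiv_of_dense ha hb hφ
  exact ⟨e, he⟩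

end Homogeneity

theorem Isomorphic.symm {L : MetricLanguage.{u, v}} {M : Type w₁} {N : Type w₂} [MetricSpace M]
    [MetricSpace N] [L.Structure M] [L.Structure N] (h : L.Isomorphic M N) :
    L.Isomorphic N M := by
  obtain ⟨e, he⟩ := h
  refine ⟨e.symm, fun f x => ?_, fun R x => ?_⟩
  · apply e.injective
    rw [he.1]
    simp only [IsometryEquiv.apply_symm_apply]
  · rw [← he.2 R]
    simp only [IsometryEquiv.apply_symm_apply]

theorem Isomorphic.trans {L : MetricLanguage.{u, v}} {M : Type w} {N : Type w₁} {P : Type w₂}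
    [MetricSpace M] [MetricSpace N] [MetricSpace P] [L.Structure M] [L.Structure N] [L.Structure P]
    (h : L.Isomorphic M N) (h' : L.Isomorphic N P) : L.Isomorphic M P := by
  obtain ⟨e, he⟩ := h
  obtain ⟨e', he'⟩ := h'
  refine ⟨e.trans e', fun f x => ?_, fun R x => ?_⟩
  · simp only [IsometryEquiv.trans_apply, he.1, he'.1]
  · simp only [IsometryEquiv.trans_apply]
    rw [he'.2 R fun i => e (x i), he.2]

/-! ### Orbit closures and characters. -/

section TypeSpace

variable {L : MetricLanguage.{u, v}} {M : Type w} [MetricSpace M] [L.Structure M] {n : ℕ∞}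

theorem eval_eq_of_tp_eq {a b : ℕ → M}
    (h : L.tp (fun i => a i : Tuple M n) = L.tp (fun i => b i : Tuple M n)) {φ : Formula L}
    (hφ : φ.freeVars ⊆ {i | (i : ℕ∞) < n}) : φ.eval a = φ.eval b := by
  obtain ⟨f, hf⟩ := exists_interprets L M n φ hφ
  have h1 := congrArg (fun p : L.TypeSpace M n => p.1
    ⟨f, (L.formulaAlgebra M n).le_topologicalClosure ⟨φ, hf⟩⟩) h
  simp only [tp_apply] at h1
  rw [← hf.2, ← hf.2, h1]

theorem mem_closure_orbit_of_tp_eq (hM : IsApproxOligomorphic (L.Aut M) M)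
    [TopologicalSpace.SeparableSpace M] {a b : Tuple M n} (h : L.tp a = L.tp b) :
    b ∈ closure (MulAction.orbit (L.Aut M) a) := by
  have : Nonempty M := Structure.nonempty L
  obtain ⟨a, rfl⟩ := exists_extend_tuple a
  obtain ⟨b, rfl⟩ := exists_extend_tuple b
  rw [mem_closure_iff_nhds]
  intro t ht
  obtain ⟨I, hI, ε, hε, hIt⟩ := exists_dist_lt_of_mem_nhds_pi ht
  -- A neighbourhood involves finitely many coordinates, which reduces n = ω to finite tuples.
  have hm : ∃ m : ℕ, (m : ℕ∞) ≤ n ∧ ∀ i ∈ I, i.1 < m := by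
    rcases I.eq_empty_or_nonempty with rfl | hne
    · exact ⟨0, by simp⟩
    · obtain ⟨k, -, hk⟩ := Set.exists_max_image I Subtype.val hI hne
      exact ⟨k.1 + 1, by exact_mod_cast Order.add_one_le_of_lt k.2,
        fun i hi => Nat.lt_succ_of_le (hk i hi)⟩
  obtain ⟨m, hmn, hm⟩ := hm
  have hT : L.TypesAgree m a b := fun φ hφ => eval_eq_of_tp_eq h fun i hi =>
    lt_of_lt_of_le (Nat.cast_lt.2 (hφ hi)) hmn
  obtain ⟨g, hg⟩ := hT.exists_aut hM hε
  exact ⟨g • fun i : {i : ℕ // (i : ℕ∞) < n} => a i, hIt _ fun i hi => hg i (hm i hi), g, rfl⟩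

theorem closure_orbit_subset_of_tp_eq (hM : IsApproxOligomorphic (L.Aut M) M)
    [TopologicalSpace.SeparableSpace M] {a b : Tuple M n} (h : L.tp a = L.tp b) :
    closure (MulAction.orbit (L.Aut M) b) ⊆ closure (MulAction.orbit (L.Aut M) a) := by
  refine closure_minimal ?_ isClosed_closure
  rintro _ ⟨g, rfl⟩
  refine mem_closure_orbit_of_tp_eq hM (h.trans ?_)
  exact L.tp_eq_of_closure_eq _ _ (by rw [MulAction.orbit_smul])

theorem orbitClosureToType_injective (hM : IsApproxOligomorphic (L.Aut M) M)
    [TopologicalSpace.SeparableSpace M] : Function.Injective (L.orbitClosureToType M n) := by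
  intro p q
  refine Quotient.inductionOn₂ p q fun a b h => Quotient.sound ?_
  exact (closure_orbit_subset_of_tp_eq hM (Eq.symm h)).antisymm (closure_orbit_subset_of_tp_eq hM h)

theorem TypeSpace.apply_sub_algebraMap (p : L.TypeSpace M n) (f : L.definablePredicates M n)
    (r : ℝ) : p.1 (f - algebraMap ℝ _ r) = p.1 f - r := by
  have h := map_sub (WeakDual.CharacterSpace.toAlgHom p.1) f (algebraMap ℝ _ r)
  rwa [AlgHom.commutes] at h

/-- A definable predicate which is positive and bounded away from zero does not vanish at a type. -/
theorem TypeSpace.apply_ne_zero (p : L.TypeSpace M n) (f : L.definablePredicates M n) {δ : ℝ}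
    (hδ : 0 < δ) (hf : ∀ a, δ ≤ f.1 a) : p.1 f ≠ 0 := by
  intro h0
  have : Nonempty M := Structure.nonempty L
  have hδf : δ ≤ ‖f‖ := (hf fun _ => Classical.arbitrary M).trans
    ((le_abs_self _).trans (f.1.norm_coe_le_norm _))
  -- The values of f lie in [δ, ‖f‖]. If p f = 0, then p has absolute value ‖f‖ at f - ‖f‖, against
  -- the norm bound on p.
  have h1 : ‖f - algebraMap ℝ (L.definablePredicates M n) ‖f‖‖ ≤ ‖f‖ - δ := by
    change ‖f.1 - algebraMap ℝ (Tuple M n →ᵇ ℝ) ‖f‖‖ ≤ ‖f‖ - δ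
    refine (BoundedContinuousFunction.norm_le (by linarith)).2 fun a => ?_
    have h2 := (le_abs_self _).trans (f.1.norm_coe_le_norm a)
    have h2' : f.1 a ≤ ‖f‖ := h2
    have h3 := hf a
    simp only [BoundedContinuousFunction.coe_sub, Pi.sub_apply,
      BoundedContinuousFunction.algebraMap_apply, smul_eq_mul, mul_one, Real.norm_eq_abs]
    rw [abs_of_nonpos (by linarith)]
    linarith
  have h2 := p.2 (f - algebraMap ℝ (L.definablePredicates M n) ‖f‖)
  rw [p.apply_sub_algebraMap, h0, zero_sub, norm_neg, norm_norm] at h2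
  linarith

/-- If no tuple approximates p on s, the sum of the squares of f - p f is at least ε ^ 2 everywhere,
yet p vanishes on it. -/
theorem TypeSpace.exists_approx (p : L.TypeSpace M n) (s : Finset (L.definablePredicates M n))
    {ε : ℝ} (hε : 0 < ε) : ∃ a : Tuple M n, ∀ f ∈ s, |f.1 a - p.1 f| < ε := by
  by_contra! hcon
  let h : L.definablePredicates M n :=
    ∑ f ∈ s, (f - algebraMap ℝ _ (p.1 f)) * (f - algebraMap ℝ _ (p.1 f))
  have heval : ∀ a, h.1 a = ∑ f ∈ s, (f.1 a - p.1 f) * (f.1 a - p.1 f) := by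
    intro a
    have := map_sum ((L.tp a).1) (fun f : L.definablePredicates M n =>
      (f - algebraMap ℝ _ (p.1 f)) * (f - algebraMap ℝ _ (p.1 f))) s
    simp only [map_mul, apply_sub_algebraMap, tp_apply] at this
    exact this
  refine p.apply_ne_zero h (pow_pos hε 2) (fun a => ?_) ?_
  · obtain ⟨f, hf, hle⟩ := hcon a
    rw [heval]
    refine le_trans ?_ (Finset.single_le_sum (f := fun f : L.definablePredicates M n =>
      (f.1 a - p.1 f) * (f.1 a - p.1 f)) (fun _ _ => mul_self_nonneg _) hf)
    change ε ^ 2 ≤ (f.1 a - p.1 f) * (f.1 a - p.1 f)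
    rw [← abs_mul_abs_self, sq]
    exact mul_self_le_mul_self hε.le hle
  · simp [h, apply_sub_algebraMap]

theorem orbitClosureToType_surjective (hM : IsApproxOligomorphic (L.Aut M) M) :
    Function.Surjective (L.orbitClosureToType M n) := by
  intro p
  have : Nonempty M := Structure.nonempty L
  have hres : Continuous fun (a : ℕ → M) (i : {i : ℕ // (i : ℕ∞) < n}) => a i := by fun_prop
  obtain ⟨x, hx, -⟩ := exists_eq_of_finitely_approximable hM
    (fun (f : L.definablePredicates M n) (a : ℕ → M) => f.1 fun i => a i)
    (fun f => f.1.continuous.comp hres) (fun f g a => L.definablePredicates_smul f g fun i => a i)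
    (fun f => p.1 f) Set.univ fun s ε hε => by
      obtain ⟨a, ha⟩ := p.exists_approx s hε
      obtain ⟨b, rfl⟩ := exists_extend_tuple a
      exact ⟨b, trivial, ha⟩
  exact ⟨Quotient.mk _ fun i => x i, Subtype.ext (Subtype.ext (DFunLike.ext _ _ hx))⟩

end TypeSpace

end MetricLanguage

theorem mainTheorem5 (L : MetricLanguage.{u, v}) (M : Type w) [MetricSpace M] [L.Structure M]
    [TopologicalSpace.SeparableSpace M] (hM : IsApproxOligomorphic (L.Aut M) M) :
    (∀ n : ℕ∞, Function.Bijective (L.orbitClosureToType M n)) ∧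
      MetricLanguage.IsAleph0Categorical.{u, v, w₁, w₂} (L.Th M) := by
  refine ⟨fun n => ⟨MetricLanguage.orbitClosureToType_injective hM,
    MetricLanguage.orbitClosureToType_surjective hM⟩, ?_⟩
  intro N N' _ _ _ _ _ _ hN hN'
  exact (MetricLanguage.isomorphic_of_isModel hM hN).symm.trans
    (MetricLanguage.isomorphic_of_isModel hM hN')
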